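/- Let $X$ be a complex Banach space with a conditional Schauder basis $(e_m)_{m\ge 1}$, i.e. a Schauder basis such that the expansion $x=\sum_{m} a_m e_m$ of some $x\in X$ does not converge unconditionally. Let $A$ be the Schauder multiplier associated to the sequence $(2^m)_{m\ge1}$, that is, $$D(A)=\Big\{x=\sum_{m=1}^\infty a_m e_m : \sum_{m=1}^\infty 2^m a_m e_m \text{ converges}\Big\},\qquad A\Big(\sum_{m=1}^\infty a_m e_m\Big)=\sum_{m=1}^\infty 2^m a_m e_m .$$ Then $A$ is a sectorial operator with sectorial angle $\omega(A)=0$, and $A$ does not have a bounded $H^\infty$-calculus. Here, for $\theta>0$, $\Sigma_\theta=\{z\in\mathbb C\setminus\{0\}: |\arg z|<\theta\}$ with $\arg z\in(-\pi,\pi]$. A closed, densely defined operator $A$ with dense range is called sectorial if for some $\omega\in(0,\pi)$ $$(S_\omega)\qquad \sigma(A)\subset\overline{\Sigma_\omega}\quad\text{and}\quad \sup_{\lambda\notin\overline{\Sigma_{\omega+\varepsilon}}}\|\lambda R(\lambda,A)\|<\infty\ \text{ for all }\varepsilon>0,$$ where $R(\lambda,A)=(\lambda-A)^{-1}$, and $\omega(A)=\inf\{\omega\in(0,\pi):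 (S_\omega)\text{ holds}\}$. For $\sigma\in(0,\pi)$ let $H_0^\infty(\Sigma_\sigma)$ be the space of holomorphic $f:\Sigma_\sigma\to\mathbb C$ with $|f(\lambda)|\le C|\lambda|^{\varepsilon}(1+|\lambda|)^{-2\varepsilon}$ on $\Sigma_\sigma$ for some $C,\varepsilon>0$, equipped with the norm $\|f\|_\infty=\sup_{\Sigma_\sigma}|f|$. A sectorial operator $A$ has a bounded $H^\infty$-calculus if for some $\sigma\in(\omega(A),\pi)$ there is a constant $K$ with $\|f(A)\|\le K\|f\|_\infty$ for all $f\in H_0^\infty(\Sigma_\sigma)$, where $$f(A)=\frac1{2\pi i}\int_{\partial\Sigma_{\sigma'}} f(\lambda)R(\lambda,A)\,d\lambda\qquad(\omega(A)<\sigma'<\sigma),$$ the boundary being oriented with $\Sigma_{\sigma'}$ on its left; the integral does not depend on $\sigma'$. -/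

import Mathlib

noncomputable section

open Set MeasureTheory Complex

namespace Sectorial

variable {X : Type*} [NormedAddCommGroup X] [NormedSpace ℂ X]

/-! ### Unbounded operators: resolvent set, spectrum, resolvent -/

/-- `R` is a two-sided bounded inverse of `lam - A : D(A) → X`. -/
def IsResolventAt (A : X →ₗ.[ℂ] X) (lam : ℂ) (R : X →L[ℂ] X) : Prop :=
  (∀ x : X, ∃ h : R x ∈ A.domain, lam • R x - A ⟨R x, h⟩ = x) ∧
    ∀ x : A.domain, R (lam • (x : X) - A x) = x

/-- The resolvent set of an unbounded operator. -/
def resolventSet (A : X →ₗ.[ℂ] X) : Set ℂ := {lam | ∃ R : X →L[ℂ] X, IsResolventAt A lam R}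

/-- The spectrum of an unbounded operator. -/
def spectrum (A : X →ₗ.[ℂ] X) : Set ℂ := (resolventSet A)ᶜ

open scoped Classical in
/-- The resolvent `R(lam, A) = (lam - A)⁻¹` for `lam` in the resolvent set
(and `0` for other `lam`). -/
def resolvent (A : X →ₗ.[ℂ] X) (lam : ℂ) : X →L[ℂ] X :=
  if h : ∃ R : X →L[ℂ] X, IsResolventAt A lam R then h.choose else 0

/-- The resolvent is characterised by being the inverse of `lam - A`. -/
theorem resolvent_spec {A : X →ₗ.[ℂ] X} {lam : ℂ} (h : lam ∈ resolventSet A) :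
    IsResolventAt A lam (resolvent A lam) := by
  have h' : ∃ R : X →L[ℂ] X, IsResolventAt A lam R := h
  rw [resolvent, dif_pos h']
  exact h'.choose_spec

/-! ### Sectorial operators -/

/-- The open sector `Σ_θ = {z ≠ 0 : |arg z| < θ}`. -/
def sector (θ : ℝ) : Set ℂ := {z | z ≠ 0 ∧ |arg z| < θ}

/-- Condition `(S_ω)`: the spectrum lies in the closure of `Σ_ω`, and `lam R(lam, A)` is uniformly
bounded off the closure of `Σ_{ω + ε}` for every `ε > 0`. -/
def SectorialCondition (A : X →ₗ.[ℂ] X) (ω : ℝ) : Prop :=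
  spectrum A ⊆ closure (sector ω) ∧
    ∀ ε > 0, ∃ C : ℝ, ∀ lam ∉ closure (sector (ω + ε)), ‖lam • resolvent A lam‖ ≤ C

/-- Sectorial operators: closed, densely defined, with dense range, and `(S_ω)` for some
`ω ∈ (0, π)`. -/
structure IsSectorial (A : X →ₗ.[ℂ] X) : Prop where
  isClosed : A.IsClosed
  dense_domain : Dense (A.domain : Set X)
  dense_range : Dense (Set.range fun x : A.domain => A x)
  exists_angle : ∃ ω ∈ Ioo 0 Real.pi, SectorialCondition A ω

/-- The sectorial angle `ω(A)`, meaningful for sectorial `A`. -/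
def sectorialAngle (A : X →ₗ.[ℂ] X) : ℝ :=
  sInf {ω | ω ∈ Ioo 0 Real.pi ∧ SectorialCondition A ω}

/-! ### The holomorphic functional calculus -/

/-- `f ∈ H₀^∞(Σ_σ)`; only the values of `f` on the sector matter. -/
def IsHZeroInfty (σ : ℝ) (f : ℂ → ℂ) : Prop :=
  DifferentiableOn ℂ f (sector σ) ∧
    ∃ C > (0 : ℝ), ∃ ε > (0 : ℝ), ∀ z ∈ sector σ, ‖f z‖ ≤ C * (‖z‖ ^ ε / (1 + ‖z‖) ^ (2 * ε))

/-- The norm of `H^∞(Σ_σ)`: the supremum of `|f|` over the sector. -/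
def hInftyNorm (σ : ℝ) (f : ℂ → ℂ) : ℝ := ⨆ z : sector σ, ‖f z‖

/-- `(2πi)⁻¹ ∫_{∂Σ_s} f(lam) R(lam, A) dlam`. The boundary of the sector is traversed with the
sector on the left: inwards along the ray of angle `s`, outwards along the ray of angle `-s`. -/
def contourIntegral (A : X →ₗ.[ℂ] X) (s : ℝ) (f : ℂ → ℂ) : X →L[ℂ] X :=
  (2 * Real.pi * I)⁻¹ •
    ((∫ t in Ioi (0 : ℝ), (f (t * exp (-(s * I))) * exp (-(s * I))) •
          resolvent A (t * exp (-(s * I)))) -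
      ∫ t in Ioi (0 : ℝ), (f (t * exp (s * I)) * exp (s * I)) • resolvent A (t * exp (s * I)))

/-- The operator `f(A)` for sectorial `A`, `f ∈ H₀^∞(Σ_σ)` and `ω(A) < σ < π`. By Cauchy's theorem
the contour integral is the same for all angles strictly between `ω(A)` and `σ`; the midpoint is
used. -/
def functionalCalculus (A : X →ₗ.[ℂ] X) (σ : ℝ) (f : ℂ → ℂ) : X →L[ℂ] X :=
  contourIntegral A ((sectorialAngle A + σ) / 2) f

/-- The homomorphism `f ↦ f(A)` from `H₀^∞(Σ_σ)`, with the supremum norm, to the bounded operators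
is bounded. -/
def HasBoundedHInftyCalculusOn (A : X →ₗ.[ℂ] X) (σ : ℝ) : Prop :=
  ∃ C : ℝ, ∀ f : ℂ → ℂ, IsHZeroInfty σ f → ‖functionalCalculus A σ f‖ ≤ C * hInftyNorm σ f

/-- A (sectorial) operator has a bounded `H^∞`-calculus if it has a bounded `H^∞(Σ_σ)`-calculus
for some `σ ∈ (ω(A), π)`. -/
def HasBoundedHInftyCalculus (A : X →ₗ.[ℂ] X) : Prop :=
  ∃ σ ∈ Ioo (sectorialAngle A) Real.pi, HasBoundedHInftyCalculusOn A σ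

/-! ### Schauder bases and Schauder multipliers -/

/-- A Schauder basis is unconditional if the basis expansion of every vector converges
unconditionally. -/
def IsUnconditional (b : SchauderBasis ℂ X) : Prop :=
  ∀ x : X, Summable fun m => b.coord m x • b m

/-- A Schauder basis is conditional if it is not unconditional. -/
def IsConditional (b : SchauderBasis ℂ X) : Prop := ¬ IsUnconditional b

/-- The Schauder multiplier associated to `γ`: its domain consists of all `x = ∑ a_m e_m` for which
the partial sums of `∑ γ_m a_m e_m` converge, and it maps `x` to the limit of these partial sums. -/
def schauderMultiplier (b : SchauderBasis ℂ X) (γ : ℕ → ℂ) : X →ₗ.[ℂ] X where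
  domain :=
    { carrier := {x | Summable (fun m => (γ m * b.coord m x) • b m) (.conditional ℕ)}
      zero_mem' := by simp [summable_zero]
      add_mem' := by
        intro x y hx hy
        simpa [mul_add, add_smul] using Summable.add hx hy
      smul_mem' := by
        intro c x hx
        have h := Summable.const_smul c hx
        refine h.congr fun m => ?_
        simp [smul_smul, mul_left_comm] }
  toFun :=
    { toFun := fun x => ∑'[.conditional ℕ] m, (γ m * b.coord m (x : X)) • b m
      map_add' := by
        intro x y
        rw [← Summable.tsum_add x.2 y.2]
        simp [mul_add, add_smul]
      map_smul' := by
        intro c x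
        rw [RingHom.id_apply, ← Summable.tsum_const_smul c x.2]
        simp [smul_smul, mul_left_comm] }

end Sectorial

end

/-!
Let `A` be the multiplier with the symbol `2 ^ (m + 1)`.

*Sectoriality.* The resolvent `R(lam, A)` has to be the multiplier with the symbol
`1 / (lam - 2 ^ (m + 1))`. Since the basis projections are uniformly bounded, Abel summation bounds
such a multiplier by the total variation of its symbol (`exists_multiplier_of_boundedVariation`).
Outside a sector `Σ_ω` the distance of `lam` to `t > 0` is comparable with `|lam| + t`, so the
variation is dominated by that of the monotone sequence `1 / (|lam| + 2 ^ (m + 1))`, hence by a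
multiple of `1 / |lam|` (`sum_norm_inv_sub_le`). This holds for every `ω ∈ (0, π)`, so the sectorial
angle is `0`.

*No bounded calculus.* On the basis vector `b m` the operator `f(A)` is multiplication by
`f (2 ^ (m + 1))`: this is Cauchy's formula for a sector (`cauchy_formula_sector`), proved on
rectangles in the coordinate `log lam`. In that coordinate the points `2 ^ (m + 1)` belong to the
lattice `ℤ log 2` and a sector becomes a strip, so translates of `sinc (π u / log 2) exp (-u²)`
interpolate bounded finite data by functions that are bounded uniformly on the sector
(`exists_interpolation`). A bounded `H^∞`-calculus would therefore bound all multipliers with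
finitely supported symbols of modulus at most `1` uniformly, which makes the basis unconditional
(`isUnconditional_of_bounded_multipliers`).
-/

noncomputable section

open Set MeasureTheory Complex Filter Topology

namespace Sectorial

variable {X : Type*} [NormedAddCommGroup X] [NormedSpace ℂ X]

section

open Finset

/-! ### Coordinates with respect to a Schauder basis -/

theorem hasSum_conditional_nat_iff {E : Type*} [AddCommMonoid E] [TopologicalSpace E] {f : ℕ → E}
    {a : E} :
    HasSum f a (.conditional ℕ) ↔ Tendsto (fun n => ∑ i ∈ range n, f i) atTop (𝓝 a) := by
  rw [HasSum, SummationFilter.conditional_filter_eq_map_range, tendsto_map'_iff]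
  rfl

theorem coord_basis (b : SchauderBasis ℂ X) (i j : ℕ) :
    b.coord i (b j) = if i = j then 1 else 0 := by
  rw [b.ortho]
  by_cases h : i = j
  · subst h; simp
  · simp [h]

theorem coord_eq_of_hasSum (b : SchauderBasis ℂ X) {a : ℕ → ℂ} {y : X}
    (h : HasSum (fun m => a m • b m) y (.conditional ℕ)) (k : ℕ) : b.coord k y = a k := by
  rw [hasSum_conditional_nat_iff] at h
  have h1 := ((b.coord k).continuous.tendsto y).comp h
  refine tendsto_nhds_unique h1 (tendsto_const_nhds.congr' ?_)
  filter_upwards [eventually_gt_atTop k] with n hn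
  simp [coord_basis, hn]

theorem ext_coord (b : SchauderBasis ℂ X) {x y : X} (h : ∀ k, b.coord k x = b.coord k y) :
    x = y := by
  have hx := b.expansion x
  simp only [h] at hx
  exact hx.unique (b.expansion y)

theorem coord_proj (b : SchauderBasis ℂ X) (k n : ℕ) (x : X) :
    b.coord k (b.proj n x) = if k < n then b.coord k x else 0 := by
  simp [coord_basis]

/-! ### Schauder multipliers -/

theorem mem_domain_iff (b : SchauderBasis ℂ X) (γ : ℕ → ℂ) (x : X) :
    x ∈ (schauderMultiplier b γ).domain ↔
      Summable (fun m => (γ m * b.coord m x) • b m) (.conditional ℕ) := Iff.rfl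

theorem hasSum_schauderMultiplier (b : SchauderBasis ℂ X) (γ : ℕ → ℂ)
    (x : (schauderMultiplier b γ).domain) :
    HasSum (fun m => (γ m * b.coord m (x : X)) • b m) (schauderMultiplier b γ x)
      (.conditional ℕ) :=
  Summable.hasSum ((mem_domain_iff b γ x).1 x.2)

theorem coord_schauderMultiplier (b : SchauderBasis ℂ X) (γ : ℕ → ℂ)
    (x : (schauderMultiplier b γ).domain) (k : ℕ) :
    b.coord k (schauderMultiplier b γ x) = γ k * b.coord k (x : X) :=
  coord_eq_of_hasSum b (hasSum_schauderMultiplier b γ x) k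

/-- A vector belongs to the domain of a Schauder multiplier as soon as some vector has the
coordinates that its image should have. -/
theorem exists_schauderMultiplier_eq (b : SchauderBasis ℂ X) {γ : ℕ → ℂ} {x y : X}
    (h : ∀ k, b.coord k y = γ k * b.coord k x) :
    ∃ hx : x ∈ (schauderMultiplier b γ).domain, schauderMultiplier b γ ⟨x, hx⟩ = y := by
  have hs : HasSum (fun m => (γ m * b.coord m x) • b m) y (.conditional ℕ) := by
    simpa only [h] using b.expansion y
  refine ⟨hs.summable, ext_coord b fun k => ?_⟩
  rw [coord_schauderMultiplier, h]

theorem schauderMultiplier_basis (b : SchauderBasis ℂ X) (γ : ℕ → ℂ) (j : ℕ) :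
    ∃ hx : b j ∈ (schauderMultiplier b γ).domain, schauderMultiplier b γ ⟨b j, hx⟩ = γ j • b j := by
  refine exists_schauderMultiplier_eq b fun k => ?_
  by_cases hk : k = j <;> simp [coord_basis, hk]

theorem isClosed_schauderMultiplier (b : SchauderBasis ℂ X) (γ : ℕ → ℂ) :
    (schauderMultiplier b γ).IsClosed := by
  have key : ((schauderMultiplier b γ).graph : Set (X × X)) =
      ⋂ k, {p : X × X | b.coord k p.2 = γ k * b.coord k p.1} := by
    ext ⟨x, y⟩
    simp only [SetLike.mem_coe, LinearPMap.mem_graph_iff, mem_iInter, mem_ofPred_eq]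
    constructor
    · rintro ⟨x, rfl, rfl⟩ k
      exact coord_schauderMultiplier b γ x k
    · intro h
      obtain ⟨hx, hy⟩ := exists_schauderMultiplier_eq b h
      exact ⟨⟨x, hx⟩, rfl, hy⟩
  rw [LinearPMap.IsClosed, key]
  exact isClosed_iInter fun k => isClosed_eq (by fun_prop) (by fun_prop)

theorem dense_of_basis_mem (b : SchauderBasis ℂ X) (S : Submodule ℂ X) (h : ∀ k, b k ∈ S) :
    Dense (S : Set X) := fun x =>
  mem_closure_of_tendsto (b.tendsto_proj x) (Eventually.of_forall fun n => by
    rw [SchauderBasis.proj_apply]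
    exact S.sum_mem fun i _ => S.smul_mem _ (h i))

theorem dense_domain_schauderMultiplier (b : SchauderBasis ℂ X) (γ : ℕ → ℂ) :
    Dense ((schauderMultiplier b γ).domain : Set X) :=
  dense_of_basis_mem b _ fun k => (schauderMultiplier_basis b γ k).1

theorem dense_range_schauderMultiplier (b : SchauderBasis ℂ X) {γ : ℕ → ℂ} (hγ : ∀ k, γ k ≠ 0) :
    Dense (Set.range fun x : (schauderMultiplier b γ).domain => schauderMultiplier b γ x) := by
  have h := dense_of_basis_mem b (LinearMap.range (schauderMultiplier b γ).toFun) fun k => by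
    obtain ⟨hx, hy⟩ := schauderMultiplier_basis b γ k
    refine ⟨(γ k)⁻¹ • ⟨b k, hx⟩, ?_⟩
    rw [map_smul]
    exact (congrArg ((γ k)⁻¹ • ·) hy).trans (inv_smul_smul₀ (hγ k) _)
  exact h

/-! ### Multiplier sequences of bounded variation -/

/-- A null sequence of bounded variation multiplies the coordinates boundedly: by Abel summation
the multiplier is `∑ (c_m - c_{m+1}) P_{m+1}`, where `P_n` are the basis projections. -/
theorem exists_multiplier_of_boundedVariation [CompleteSpace X] (b : SchauderBasis ℂ X) {K : ℝ}
    (hK : ∀ n, ‖b.proj n‖ ≤ K) {c : ℕ → ℂ} {V : ℝ} (hc : Tendsto c atTop (𝓝 0))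
    (hV : ∀ n, ∑ m ∈ range n, ‖c m - c (m + 1)‖ ≤ V) :
    ∃ T : X →L[ℂ] X, ‖T‖ ≤ V * K ∧ ∀ x k, b.coord k (T x) = c k * b.coord k x := by
  have hK0 : 0 ≤ K := (norm_nonneg _).trans (hK 0)
  have hs : Summable fun m => ‖c m - c (m + 1)‖ :=
    summable_of_sum_range_le (fun _ => norm_nonneg _) hV
  have hle : ∀ m, ‖(c m - c (m + 1)) • b.proj (m + 1)‖ ≤ ‖c m - c (m + 1)‖ * K := fun m => by
    rw [norm_smul]
    exact mul_le_mul_of_nonneg_left (hK _) (norm_nonneg _)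
  have hT : Summable fun m => (c m - c (m + 1)) • b.proj (m + 1) :=
    .of_norm_bounded (hs.mul_right K) hle
  refine ⟨∑' m, (c m - c (m + 1)) • b.proj (m + 1), ?_, fun x k => ?_⟩
  · refine (tsum_of_norm_bounded (hs.mul_right K).hasSum hle).trans ?_
    rw [tsum_mul_right]
    exact mul_le_mul_of_nonneg_right
      (hs.tsum_le_of_sum_range_le hV) hK0
  · have h1 := hT.hasSum.mapL ((b.coord k).comp (ContinuousLinearMap.apply ℂ X x))
    refine tendsto_nhds_unique h1.tendsto_sum_nat ?_
    have h2 : Tendsto (fun n => (c k - c n) * b.coord k x) atTop (𝓝 (c k * b.coord k x)) := by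
      simpa using (tendsto_const_nhds.sub hc).mul_const (b.coord k x)
    refine h2.congr' ?_
    filter_upwards [eventually_ge_atTop k] with n hn
    induction n, hn using Nat.le_induction with
    | base =>
      rw [Finset.sum_eq_zero]
      · simp
      · intro i hi
        have : ¬ k < i + 1 := by have := Finset.mem_range.1 hi; omega
        simp only [ContinuousLinearMap.comp_apply, ContinuousLinearMap.apply_apply, map_smul,
          coord_proj, if_neg this, smul_zero]
    | succ n hn ih =>
      have : k < n + 1 := by omega
      rw [Finset.sum_range_succ, ← ih]
      simp only [ContinuousLinearMap.comp_apply, ContinuousLinearMap.apply_apply, map_smul,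
        coord_proj, if_pos this, smul_eq_mul]
      ring

/-! ### Resolvents -/

theorem IsResolventAt.eq {A : X →ₗ.[ℂ] X} {lam : ℂ} {R R' : X →L[ℂ] X}
    (h : IsResolventAt A lam R) (h' : IsResolventAt A lam R') : R = R' := by
  ext x
  obtain ⟨hx, e⟩ := h'.1 x
  have := h.2 ⟨R' x, hx⟩
  rwa [e] at this

theorem IsResolventAt.resolvent_eq {A : X →ₗ.[ℂ] X} {lam : ℂ} {R : X →L[ℂ] X}
    (h : IsResolventAt A lam R) : resolvent A lam = R :=
  (resolvent_spec ⟨R, h⟩).eq h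

theorem resolvent_sub_resolvent {A : X →ₗ.[ℂ] X} {lam mu : ℂ} (hl : lam ∈ resolventSet A)
    (hm : mu ∈ resolventSet A) :
    resolvent A lam - resolvent A mu = (mu - lam) • (resolvent A lam ∘L resolvent A mu) := by
  ext x
  obtain ⟨hx, e⟩ := (resolvent_spec hm).1 x
  have h := (resolvent_spec hl).2 ⟨_, hx⟩
  have e2 : A ⟨_, hx⟩ = mu • resolvent A mu x - x :=
    eq_sub_of_add_eq' (eq_add_of_sub_eq e).symm
  rw [e2] at h
  simp only [map_sub, map_smul] at h
  have h' : resolvent A lam x = resolvent A mu x - lam • resolvent A lam (resolvent A mu x) +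
      mu • resolvent A lam (resolvent A mu x) := by
    rw [sub_eq_iff_eq_add] at h
    rw [h]
    abel
  simp only [sub_apply, smul_apply, ContinuousLinearMap.comp_apply, sub_smul, h']
  abel

/-- A point `lam ∉ Σ_ω` keeps its distance from the positive half-line: with
`κ² = (1 - cos ω) / 2`, the inequality `κ² (r + t)² ≤ r² + t² - 2 r t cos ω` reduces to
`(1 + cos ω) (r - t)² ≥ 0`. -/
theorem norm_sub_ofReal_ge {ω : ℝ} (hω : ω ∈ Ioo 0 Real.pi) {lam : ℂ} (hlam : ω ≤ |arg lam|)
    {t : ℝ} (ht : 0 ≤ t) :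
    √((1 - Real.cos ω) / 2) * (‖lam‖ + t) ≤ ‖lam - t‖ := by
  have hre : lam.re ≤ ‖lam‖ * Real.cos ω := by
    rw [← norm_mul_cos_arg lam, ← Real.cos_abs (arg lam)]
    exact mul_le_mul_of_nonneg_left
      (Real.cos_le_cos_of_nonneg_of_le_pi hω.1.le (abs_arg_le_pi lam) hlam) (norm_nonneg _)
  have hsq : ‖lam - t‖ ^ 2 = ‖lam‖ ^ 2 + t ^ 2 - 2 * t * lam.re := by
    rw [← normSq_eq_norm_sq, ← normSq_eq_norm_sq, normSq_apply, normSq_apply]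
    simp
    ring
  have hc := Real.cos_le_one ω
  refine le_of_sq_le_sq ?_ (norm_nonneg _)
  rw [mul_pow, Real.sq_sqrt (by linarith), hsq]
  nlinarith [mul_le_mul_of_nonneg_left hre ht,
    mul_nonneg (by linarith [Real.neg_one_le_cos ω] : 0 ≤ 1 + Real.cos ω) (sq_nonneg (‖lam‖ - t))]

theorem sqrt_one_sub_cos_pos {ω : ℝ} (hω : ω ∈ Ioo 0 Real.pi) : 0 < √((1 - Real.cos ω) / 2) := by
  have : Real.cos ω < 1 := by
    rw [← Real.cos_zero]
    exact Real.cos_lt_cos_of_nonneg_of_le_pi le_rfl hω.2.le hω.1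
  exact Real.sqrt_pos.2 (by linarith)

/-- The total variation of `1 / (lam - 2 ^ (m + 1))`: since `lam - t` is comparable with `|lam| + t`,
the increments are dominated by those of the monotone sequence `1 / (|lam| + 2 ^ (m + 1))`. -/
theorem sum_norm_inv_sub_le {κ : ℝ} (hκ : 0 < κ) {lam : ℂ} (h0 : lam ≠ 0)
    (hlam : ∀ t : ℝ, 0 ≤ t → κ * (‖lam‖ + t) ≤ ‖lam - t‖) (n : ℕ) :
    ∑ m ∈ range n, ‖(lam - 2 ^ (m + 1))⁻¹ - (lam - 2 ^ (m + 1 + 1))⁻¹‖ ≤ (κ ^ 2)⁻¹ * ‖lam‖⁻¹ := by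
  have hl : 0 < ‖lam‖ := norm_pos_iff.2 h0
  have hstep : ∀ m : ℕ, ‖(lam - 2 ^ (m + 1))⁻¹ - (lam - 2 ^ (m + 1 + 1))⁻¹‖ ≤
      (κ ^ 2)⁻¹ * ((‖lam‖ + 2 ^ (m + 1))⁻¹ - (‖lam‖ + 2 ^ (m + 1 + 1))⁻¹) := fun m => by
    have p1 : (0 : ℝ) < 2 ^ (m + 1) := by positivity
    have a1 := hlam (2 ^ (m + 1)) (by positivity)
    have a2 := hlam (2 ^ (m + 1 + 1)) (by positivity)
    push_cast at a1 a2
    have q1 : 0 < ‖lam - 2 ^ (m + 1)‖ := lt_of_lt_of_le (by positivity) a1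
    have q2 : 0 < ‖lam - 2 ^ (m + 1 + 1)‖ := lt_of_lt_of_le (by positivity) a2
    rw [inv_sub_inv (norm_pos_iff.1 q1) (norm_pos_iff.1 q2), inv_sub_inv (by positivity)
      (by positivity), norm_div, norm_mul]
    have e1 : ‖lam - 2 ^ (m + 1 + 1) - (lam - 2 ^ (m + 1))‖ = 2 ^ (m + 1) := by
      rw [show lam - 2 ^ (m + 1 + 1) - (lam - 2 ^ (m + 1)) = -2 ^ (m + 1) by ring]
      simp
    rw [e1, show ‖lam‖ + 2 ^ (m + 1 + 1) - (‖lam‖ + 2 ^ (m + 1)) = (2 : ℝ) ^ (m + 1) by ring,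
      inv_mul_eq_div, div_div]
    refine div_le_div_of_nonneg_left p1.le (by positivity) ?_
    calc _ = (κ * (‖lam‖ + 2 ^ (m + 1))) * (κ * (‖lam‖ + 2 ^ (m + 1 + 1))) := by ring
      _ ≤ _ := mul_le_mul a1 a2 (by positivity) q1.le
  refine (Finset.sum_le_sum fun m _ => hstep m).trans ?_
  rw [← Finset.mul_sum, Finset.sum_range_sub' fun m : ℕ => (‖lam‖ + 2 ^ (m + 1))⁻¹]
  refine mul_le_mul_of_nonneg_left ?_ (by positivity)
  have : (‖lam‖ + 2 ^ (0 + 1))⁻¹ ≤ ‖lam‖⁻¹ := inv_anti₀ hl (by norm_num)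
  have : 0 ≤ (‖lam‖ + 2 ^ (n + 1))⁻¹ := by positivity
  linarith

theorem tendsto_inv_sub_two_pow (lam : ℂ) :
    Tendsto (fun m : ℕ => (lam - 2 ^ (m + 1))⁻¹) atTop (𝓝 0) := by
  refine tendsto_inv₀_cobounded.comp ?_
  rw [← tendsto_norm_atTop_iff_cobounded]
  have h : Tendsto (fun m : ℕ => (2 : ℝ) ^ (m + 1) - ‖lam‖) atTop atTop :=
    tendsto_atTop_add_const_right _ _
      ((tendsto_pow_atTop_atTop_of_one_lt one_lt_two).comp (tendsto_add_atTop_nat 1))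
  refine tendsto_atTop_mono (fun m => ?_) h
  have := norm_sub_norm_le (2 ^ (m + 1) : ℂ) lam
  rw [norm_sub_rev] at this
  simpa using this

/-- A multiplier with the symbol `1 / (lam - γ_m)` inverts `lam - A`, where `A` has the symbol
`γ_m`. -/
theorem isResolventAt_of_coord (b : SchauderBasis ℂ X) {γ : ℕ → ℂ} {lam : ℂ} {T : X →L[ℂ] X}
    (hγ : ∀ k, lam - γ k ≠ 0) (hT : ∀ x k, b.coord k (T x) = (lam - γ k)⁻¹ * b.coord k x) :
    IsResolventAt (schauderMultiplier b γ) lam T := by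
  refine ⟨fun x => ?_, fun x => ext_coord b fun k => ?_⟩
  · obtain ⟨h, e⟩ := exists_schauderMultiplier_eq (γ := γ) (x := T x) (y := lam • T x - x) b
      fun k => by
        simp only [map_sub, map_smul, hT, smul_eq_mul]
        field_simp [hγ k]
        ring
    exact ⟨h, by rw [e]; abel⟩
  · rw [hT, map_sub, map_smul, coord_schauderMultiplier, smul_eq_mul, ← sub_mul,
      inv_mul_cancel_left₀ (hγ k)]

/-- The resolvent estimate for the multiplier with the symbol `2 ^ (m + 1)`, outside a sector. -/
theorem exists_resolvent_bound [CompleteSpace X] (b : SchauderBasis ℂ X) {ω : ℝ}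
    (hω : ω ∈ Ioo 0 Real.pi) :
    ∃ C : ℝ, ∀ lam : ℂ, lam ≠ 0 → ω ≤ |arg lam| →
      lam ∈ resolventSet (schauderMultiplier b fun m => 2 ^ (m + 1)) ∧
        ‖lam‖ * ‖resolvent (schauderMultiplier b fun m => 2 ^ (m + 1)) lam‖ ≤ C := by
  obtain ⟨K, hK⟩ := b.exists_norm_proj_le
  have hκ := sqrt_one_sub_cos_pos hω
  set κ := √((1 - Real.cos ω) / 2)
  refine ⟨(κ ^ 2)⁻¹ * K, fun lam h0 hlam => ?_⟩
  have hl : 0 < ‖lam‖ := norm_pos_iff.2 h0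
  have hd : ∀ t : ℝ, 0 ≤ t → κ * (‖lam‖ + t) ≤ ‖lam - t‖ := fun t ht =>
    norm_sub_ofReal_ge hω hlam ht
  obtain ⟨T, hT1, hT2⟩ := exists_multiplier_of_boundedVariation b hK (tendsto_inv_sub_two_pow lam)
    (sum_norm_inv_sub_le hκ h0 hd)
  have hR : IsResolventAt (schauderMultiplier b fun m => 2 ^ (m + 1)) lam T := by
    refine isResolventAt_of_coord b (fun k => ?_) hT2
    have := hd (2 ^ (k + 1)) (by positivity)
    push_cast at this
    exact norm_pos_iff.1 (lt_of_lt_of_le (by positivity) this)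
  refine ⟨⟨T, hR⟩, ?_⟩
  rw [hR.resolvent_eq]
  calc ‖lam‖ * ‖T‖ ≤ ‖lam‖ * ((κ ^ 2)⁻¹ * ‖lam‖⁻¹ * K) := by gcongr
    _ = _ := by field_simp

/-! ### Sectoriality -/

theorem zero_mem_closure_sector {θ : ℝ} (hθ : 0 < θ) : (0 : ℂ) ∈ closure (sector θ) := by
  have h : Tendsto (fun n : ℕ => (((1 : ℝ) / ((n : ℝ) + 1) : ℝ) : ℂ)) atTop (𝓝 0) := by
    have := (continuous_ofReal.tendsto 0).comp tendsto_one_div_add_atTop_nhds_zero_nat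
    simpa only [Function.comp_def, ofReal_zero] using this
  refine mem_closure_of_tendsto h (Eventually.of_forall fun n => ⟨?_, ?_⟩)
  · exact_mod_cast (by positivity : (1 : ℝ) / ((n : ℝ) + 1) ≠ 0)
  · rw [arg_ofReal_of_nonneg (by positivity), abs_zero]
    exact hθ

theorem sectorialCondition_two_pow [CompleteSpace X] (b : SchauderBasis ℂ X) {ω : ℝ}
    (hω : ω ∈ Ioo 0 Real.pi) :
    SectorialCondition (schauderMultiplier b fun m => 2 ^ (m + 1)) ω := by
  obtain ⟨C, hC⟩ := exists_resolvent_bound b hω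
  -- `0` lies in the closure of every sector, so the estimate at `lam = 0` is never needed.
  have key : ∀ θ, ω ≤ θ → ∀ lam ∉ closure (sector θ), lam ≠ 0 ∧ ω ≤ |arg lam| :=
    fun θ hθ lam hl => by
      have h0 : lam ≠ 0 := by
        rintro rfl
        exact hl (zero_mem_closure_sector (hω.1.trans_le hθ))
      refine ⟨h0, hθ.trans ?_⟩
      by_contra! h
      exact hl (subset_closure ⟨h0, h⟩)
  refine ⟨fun lam hlam => ?_, fun ε hε => ⟨C, fun lam hlam => ?_⟩⟩
  · by_contra h
    obtain ⟨h0, h1⟩ := key ω le_rfl lam h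
    exact hlam (hC lam h0 h1).1
  · obtain ⟨h0, h1⟩ := key (ω + ε) (by linarith) lam hlam
    rw [norm_smul]
    exact (hC lam h0 h1).2

theorem isSectorial_two_pow [CompleteSpace X] (b : SchauderBasis ℂ X) :
    IsSectorial (schauderMultiplier b fun m => 2 ^ (m + 1)) where
  isClosed := isClosed_schauderMultiplier b _
  dense_domain := dense_domain_schauderMultiplier b _
  dense_range := dense_range_schauderMultiplier b fun k => pow_ne_zero _ two_ne_zero
  exists_angle :=
    have h : Real.pi / 2 ∈ Ioo 0 Real.pi := ⟨Real.pi_div_two_pos, by linarith [Real.pi_pos]⟩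
    ⟨_, h, sectorialCondition_two_pow b h⟩

theorem sectorialAngle_two_pow [CompleteSpace X] (b : SchauderBasis ℂ X) :
    sectorialAngle (schauderMultiplier b fun m => 2 ^ (m + 1)) = 0 := by
  have : {ω | ω ∈ Ioo 0 Real.pi ∧
      SectorialCondition (schauderMultiplier b fun m => 2 ^ (m + 1)) ω} = Ioo 0 Real.pi :=
    Set.ext fun ω => and_iff_left_of_imp fun h => sectorialCondition_two_pow b h
  rw [sectorialAngle, this, csInf_Ioo Real.pi_pos]

end

/-! ### Sectors in logarithmic coordinates -/

theorem sector_subset_slitPlane {σ : ℝ} (hσ : σ ≤ Real.pi) : sector σ ⊆ slitPlane := fun z hz => by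
  refine mem_slitPlane_iff_arg.2 ⟨fun h => ?_, hz.1⟩
  have := hz.2
  rw [h, abs_of_pos Real.pi_pos] at this
  linarith

theorem isOpen_sector {σ : ℝ} (hσ : σ ≤ Real.pi) : IsOpen (sector σ) := by
  have h : sector σ = slitPlane ∩ (fun z => |arg z|) ⁻¹' Iio σ := by
    ext z
    exact ⟨fun hz => ⟨sector_subset_slitPlane hσ hz, hz.2⟩,
      fun hz => ⟨slitPlane_ne_zero hz.1, hz.2⟩⟩
  rw [h]
  refine ContinuousOn.isOpen_inter_preimage (fun z hz => ?_) isOpen_slitPlane isOpen_Iio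
  exact (continuousAt_arg hz).abs.continuousWithinAt

theorem arg_exp_of_abs_im_lt {w : ℂ} (h : |w.im| < Real.pi) : arg (exp w) = w.im := by
  rw [← log_im, log_exp (abs_lt.1 h).1 (abs_lt.1 h).2.le]

theorem exp_mem_sector {σ : ℝ} (hσ : σ ≤ Real.pi) {w : ℂ} (h : |w.im| < σ) :
    exp w ∈ sector σ :=
  ⟨exp_ne_zero w, by rwa [arg_exp_of_abs_im_lt (h.trans_le hσ)]⟩

theorem ofReal_mem_sector {σ : ℝ} (hσ : 0 < σ) {t : ℝ} (ht : 0 < t) : (t : ℂ) ∈ sector σ :=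
  ⟨ofReal_ne_zero.2 ht.ne', by rwa [arg_ofReal_of_nonneg ht.le, abs_zero]⟩

theorem eq_log_of_exp_eq {t : ℝ} {w : ℂ} (hw : |w.im| < Real.pi) (h : exp w = t) :
    w.re = Real.log t ∧ w.im = 0 := by
  have h2 := log_exp (abs_lt.1 hw).1 (abs_lt.1 hw).2.le
  rw [h] at h2
  constructor
  · rw [← h2, log_ofReal_re]
  · have ht : 0 ≤ t := by
      by_contra! ht
      have h3 := congrArg Complex.im h2
      rw [log_im, arg_ofReal_of_neg ht] at h3
      rw [← h3, abs_of_pos Real.pi_pos] at hw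
      exact lt_irrefl _ hw
    rw [← h2, log_im, arg_ofReal_of_nonneg ht]

/-! ### Cauchy's formula on a sector -/

/-- The logarithmic derivative of `exp w - t` has the integral `2πi` over the boundary of a
rectangle around `log t` of height less than `2π`. The branch `log (exp w - t)` is smooth along
three sides and `log (t - exp w)` along the left one; they differ by `± πi` at the left corners. -/
theorem rectangle_integral_exp_div {a b s t : ℝ} (ht : 0 < t) (ha : a < Real.log t)
    (hb : Real.log t < b) (hs : 0 < s) (hsπ : s < Real.pi) :
    (∫ x : ℝ in a..b, exp (x + (-s : ℝ) * I) / (exp (x + (-s : ℝ) * I) - t)) -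
      (∫ x : ℝ in a..b, exp (x + s * I) / (exp (x + s * I) - t)) +
      I * (∫ y : ℝ in -s..s, exp (b + y * I) / (exp (b + y * I) - t)) -
      I * (∫ y : ℝ in -s..s, exp (a + y * I) / (exp (a + y * I) - t)) = 2 * Real.pi * I := by
  have him : ∀ x y : ℝ, (exp (x + y * I) - t).im = Real.exp x * Real.sin y := fun x y => by
    rw [sub_im, exp_im]; simp
  have hre : ∀ x : ℝ, (exp (x + (0 : ℝ) * I) - t).re = Real.exp x - t := fun x => by
    rw [sub_re, exp_re]; simp
  have hsin : ∀ y : ℝ, y ∈ Icc (-s) s → y ≠ 0 → Real.sin y ≠ 0 := fun y hy h0 h => by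
    refine h0 ?_
    exact (Real.sin_eq_zero_iff_of_lt_of_lt (by linarith [hy.1]) (by linarith [hy.2])).1 h
  have hs0 : 0 < Real.sin s := Real.sin_pos_of_pos_of_lt_pi hs hsπ
  -- Along the right, upper and lower sides.
  have hslit : ∀ x y : ℝ, y ∈ Icc (-s) s → (y = 0 → Real.log t < x) →
      exp (x + y * I) - t ∈ slitPlane := fun x y hy h => by
    by_cases h0 : y = 0
    · left
      rw [h0, hre]
      have := (Real.log_lt_iff_lt_exp ht).1 (h h0)
      linarith
    · right
      rw [him]
      exact mul_ne_zero (Real.exp_pos x).ne' (hsin y hy h0)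
  -- Along the left side.
  have hslit' : ∀ y : ℝ, y ∈ Icc (-s) s → t - exp (a + y * I) ∈ slitPlane := fun y hy => by
    rw [← neg_sub]
    by_cases h0 : y = 0
    · left
      rw [h0, neg_re, hre]
      have := (Real.lt_log_iff_exp_lt ht).1 ha
      linarith
    · right
      rw [neg_im, him]
      exact neg_ne_zero.2 (mul_ne_zero (Real.exp_pos a).ne' (hsin y hy h0))
  have hd : ∀ w : ℂ, HasDerivAt (fun w => exp w - t) (exp w) w := fun w =>
    (hasDerivAt_exp w).sub_const _
  have hline : ∀ (y x : ℝ), HasDerivAt (fun x : ℝ => (x : ℂ) + y * I) 1 x := fun y x =>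
    ((hasDerivAt_id x).ofReal_comp).add_const _
  have hcol : ∀ (c y : ℝ), HasDerivAt (fun y : ℝ => (c : ℂ) + y * I) I y := fun c y => by
    simpa using (((hasDerivAt_id y).ofReal_comp).mul_const I).const_add (c : ℂ)
  have horiz : ∀ y : ℝ, y ∈ Icc (-s) s → y ≠ 0 →
      ∫ x : ℝ in a..b, exp (x + y * I) / (exp (x + y * I) - t) =
        log (exp (b + y * I) - t) - log (exp (a + y * I) - t) := fun y hy h0 => by
    refine intervalIntegral.integral_eq_sub_of_hasDerivAt
      (f := fun x : ℝ => log (exp (x + y * I) - t)) (fun x _ => ?_)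
      (ContinuousOn.intervalIntegrable fun x _ => ?_)
    · have h1 := (hd (x + y * I)).comp x (hline y x)
      rw [mul_one] at h1
      exact h1.clog_real (hslit x y hy fun h => absurd h h0)
    · have := slitPlane_ne_zero (hslit x y hy fun h => absurd h h0)
      exact ContinuousAt.continuousWithinAt (by fun_prop (disch := assumption))
  have hright : I * ∫ y : ℝ in -s..s, exp (b + y * I) / (exp (b + y * I) - t) =
      log (exp (b + s * I) - t) - log (exp (b + (-s : ℝ) * I) - t) := by
    rw [← intervalIntegral.integral_const_mul]
    refine intervalIntegral.integral_eq_sub_of_hasDerivAt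
      (f := fun y : ℝ => log (exp (b + y * I) - t)) (fun y hy => ?_)
      (ContinuousOn.intervalIntegrable fun y hy => ?_)
    all_goals rw [uIcc_of_le (by linarith)] at hy
    · have h1 := (hd (b + y * I)).comp y (hcol b y)
      refine (h1.clog_real (hslit b y hy fun _ => hb)).congr_deriv ?_
      simp only [Function.comp_apply]
      ring
    · have := slitPlane_ne_zero (hslit b y hy fun _ => hb)
      exact ContinuousAt.continuousWithinAt (by fun_prop (disch := assumption))
  have hleft : I * ∫ y : ℝ in -s..s, exp (a + y * I) / (exp (a + y * I) - t) =
      log (t - exp (a + s * I)) - log (t - exp (a + (-s : ℝ) * I)) := by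
    rw [← intervalIntegral.integral_const_mul]
    refine intervalIntegral.integral_eq_sub_of_hasDerivAt
      (f := fun y : ℝ => log (t - exp (a + y * I))) (fun y hy => ?_)
      (ContinuousOn.intervalIntegrable fun y hy => ?_)
    all_goals rw [uIcc_of_le (by linarith)] at hy
    · have h1 := ((hasDerivAt_exp (a + y * I)).const_sub (t : ℂ)).comp y (hcol a y)
      refine (h1.clog_real (hslit' y hy)).congr_deriv ?_
      simp only [Function.comp_apply]
      rw [← neg_sub, div_neg, neg_mul, neg_div]
      ring
    · have h1 := slitPlane_ne_zero (hslit' y hy)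
      have : exp (a + y * I) - t ≠ 0 := by rwa [← neg_sub, neg_ne_zero]
      exact ContinuousAt.continuousWithinAt (by fun_prop (disch := assumption))
  have hlog1 : log (t - exp (a + s * I)) = log (exp (a + s * I) - t) - Real.pi * I := by
    have h : 0 < (exp (a + s * I) - t).im := by rw [him]; positivity
    rw [← neg_sub, log, log, arg_neg_eq_arg_sub_pi_of_im_pos h, norm_neg]
    push_cast; ring
  have hlog2 : log (t - exp (a + (-s : ℝ) * I)) =
      log (exp (a + (-s : ℝ) * I) - t) + Real.pi * I := by
    have h : (exp (a + (-s : ℝ) * I) - t).im < 0 := by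
      rw [him, Real.sin_neg]
      have : 0 < Real.exp a * Real.sin s := by positivity
      linarith
    rw [← neg_sub, log, log, arg_neg_eq_arg_add_pi_of_im_neg h, norm_neg]
    push_cast; ring
  rw [horiz (-s) ⟨le_rfl, by linarith⟩ (by linarith), horiz s ⟨by linarith, le_rfl⟩ hs.ne', hright,
    hleft, hlog1, hlog2]
  ring

/-- Cauchy's formula for a truncated sector, in logarithmic coordinates. -/
theorem rectangle_integral_cauchy {f : ℂ → ℂ} {σ : ℝ} (hσ : σ ≤ Real.pi)
    (hf : DifferentiableOn ℂ f (sector σ)) {a b s t : ℝ} (ht : 0 < t) (ha : a < Real.log t)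
    (hb : Real.log t < b) (hs : 0 < s) (hsσ : s < σ) :
    (∫ x : ℝ in a..b, f (exp (x + (-s : ℝ) * I)) * exp (x + (-s : ℝ) * I) /
        (exp (x + (-s : ℝ) * I) - t)) -
      (∫ x : ℝ in a..b, f (exp (x + s * I)) * exp (x + s * I) / (exp (x + s * I) - t)) +
      I * (∫ y : ℝ in -s..s, f (exp (b + y * I)) * exp (b + y * I) / (exp (b + y * I) - t)) -
      I * (∫ y : ℝ in -s..s, f (exp (a + y * I)) * exp (a + y * I) / (exp (a + y * I) - t)) =
      2 * Real.pi * I * f t := by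
  have hg : DifferentiableOn ℂ (dslope f t) (sector σ) :=
    (differentiableOn_dslope ((isOpen_sector hσ).mem_nhds (ofReal_mem_sector (hs.trans hsσ) ht))).2
      hf
  have hF : DifferentiableOn ℂ (fun w => dslope f t (exp w) * exp w) {w | |w.im| < σ} :=
    (hg.comp differentiable_exp.differentiableOn fun w hw => exp_mem_sector hσ hw).mul
      differentiable_exp.differentiableOn
  -- The difference quotient of `f` at `t` contributes nothing.
  have h1 := integral_boundary_rect_eq_zero_of_differentiableOn
    (fun w => dslope f t (exp w) * exp w) ⟨a, -s⟩ ⟨b, s⟩ (hF.mono fun w hw => by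
      have h2 : w.im ∈ uIcc (-s) s := hw.2
      rw [uIcc_of_le (by linarith)] at h2
      exact (abs_le.2 h2).trans_lt hsσ)
  have h2 := rectangle_integral_exp_div ht ha hb hs (hsσ.trans_le hσ)
  -- Along a path that avoids the pole, the integrand splits off the difference quotient.
  have split : ∀ (φ : ℝ → ℂ) (p q : ℝ), Continuous φ → (∀ x ∈ uIcc p q, |(φ x).im| < σ) →
      (∀ x ∈ uIcc p q, (φ x).im = 0 → (φ x).re ≠ Real.log t) →
      ∫ x in p..q, f (exp (φ x)) * exp (φ x) / (exp (φ x) - t) =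
        (∫ x in p..q, dslope f t (exp (φ x)) * exp (φ x)) +
          f t * ∫ x in p..q, exp (φ x) / (exp (φ x) - t) := by
    intro φ p q hφ him hne
    have hne' : ∀ x ∈ uIcc p q, exp (φ x) - t ≠ 0 := fun x hx h => by
      obtain ⟨h3, h4⟩ := eq_log_of_exp_eq ((him x hx).trans_le hσ) (sub_eq_zero.1 h)
      exact hne x hx h4 h3
    rw [← intervalIntegral.integral_const_mul, ← intervalIntegral.integral_add]
    · refine intervalIntegral.integral_congr fun x hx => ?_
      have h3 := hne' x hx
      rw [dslope_of_ne _ (sub_ne_zero.1 h3), slope_def_field]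
      field_simp
      ring
    · exact (hF.continuousOn.comp hφ.continuousOn him).intervalIntegrable
    · refine ContinuousOn.intervalIntegrable ?_
      have he : Continuous fun x => exp (φ x) := continuous_exp.comp hφ
      exact continuousOn_const.mul (he.continuousOn.div (he.sub continuous_const).continuousOn hne')
  have hy : ∀ y ∈ uIcc (-s) s, |y| < σ := fun y hy => by
    rw [uIcc_of_le (by linarith)] at hy
    exact (abs_le.2 hy).trans_lt hsσ
  rw [split (fun x : ℝ => x + (-s : ℝ) * I) a b (by fun_prop)
      (fun x _ => by simpa [abs_of_pos hs] using hsσ) (fun x _ h => by simp [hs.ne'] at h),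
    split (fun x : ℝ => x + s * I) a b (by fun_prop)
      (fun x _ => by simpa [abs_of_pos hs] using hsσ) (fun x _ h => by simp [hs.ne'] at h),
    split (fun y : ℝ => b + y * I) (-s) s (by fun_prop) (fun y h => by simpa using hy y h)
      (fun y _ _ => by simpa using hb.ne'),
    split (fun y : ℝ => a + y * I) (-s) s (by fun_prop) (fun y h => by simpa using hy y h)
      (fun y _ _ => by simpa using ha.ne)]
  simp only [smul_eq_mul] at h1
  linear_combination h1 + f t * h2

theorem integrableOn_inv_one_add_sq : IntegrableOn (fun r : ℝ => ((1 + r) ^ 2)⁻¹) (Ioi 0) := by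
  refine Integrable.mono' integrable_inv_one_add_sq.integrableOn
    (by fun_prop) ((ae_restrict_iff' measurableSet_Ioi).2 (.of_forall fun r hr => ?_))
  have hr : 0 < r := hr
  rw [Real.norm_of_nonneg (by positivity)]
  exact inv_anti₀ (by positivity) (by nlinarith)

theorem norm_ofReal_mul_exp {r : ℝ} (hr : 0 ≤ r) (θ : ℝ) : ‖(r : ℂ) * exp (θ * I)‖ = r := by
  rw [norm_mul, norm_exp_ofReal_mul_I, mul_one, norm_real, Real.norm_of_nonneg hr]

theorem arg_ofReal_mul_exp {r θ : ℝ} (hr : 0 < r) (hθ : |θ| < Real.pi) :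
    arg ((r : ℂ) * exp (θ * I)) = θ := by
  rw [arg_real_mul _ hr, arg_exp_of_abs_im_lt (by simpa using hθ)]
  simp

theorem ofReal_mul_exp_mem_sector {σ : ℝ} (hσ : σ ≤ Real.pi) {r θ : ℝ} (hr : 0 < r)
    (hθ : |θ| < σ) : (r : ℂ) * exp (θ * I) ∈ sector σ :=
  ⟨mul_ne_zero (ofReal_ne_zero.2 hr.ne') (exp_ne_zero _), by
    rwa [arg_ofReal_mul_exp hr (hθ.trans_le hσ)]⟩

/-- On a ray inside the sector, the product of a function decaying like `|z| / (1 + |z|)²` with an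
operator or number valued function of size `O(1 / |z|)` is integrable. -/
theorem integrableOn_ray {E : Type*} [NormedAddCommGroup E] [NormedSpace ℂ E] {f : ℂ → ℂ}
    {σ C : ℝ} (hσ : σ ≤ Real.pi) (hf : DifferentiableOn ℂ f (sector σ))
    (hC : ∀ z ∈ sector σ, ‖f z‖ ≤ C * (‖z‖ / (1 + ‖z‖) ^ 2)) {θ : ℝ} (hθ : |θ| < σ) {g : ℝ → E}
    (hg : ContinuousOn g (Ioi 0)) {D : ℝ} (hD : ∀ r, 0 < r → r * ‖g r‖ ≤ D) :
    IntegrableOn (fun r : ℝ => (f (r * exp (θ * I)) * exp (θ * I)) • g r) (Ioi 0) := by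
  have hmaps : MapsTo (fun r : ℝ => (r : ℂ) * exp (θ * I)) (Ioi 0) (sector σ) := fun r hr =>
    ofReal_mul_exp_mem_sector hσ hr hθ
  have hcont : ContinuousOn (fun r : ℝ => (f (r * exp (θ * I)) * exp (θ * I)) • g r) (Ioi 0) :=
    ((hf.continuousOn.comp (by fun_prop) hmaps).mul continuousOn_const).smul hg
  refine Integrable.mono' (integrableOn_inv_one_add_sq.const_mul (C * D))
    (hcont.aestronglyMeasurable measurableSet_Ioi)
    ((ae_restrict_iff' measurableSet_Ioi).2 (.of_forall fun r hr => ?_))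
  have hr : 0 < r := hr
  have h1 := hC _ (hmaps hr)
  rw [norm_ofReal_mul_exp hr.le] at h1
  have h0 : 0 ≤ C * (r / (1 + r) ^ 2) := (norm_nonneg _).trans h1
  have hC0 : 0 ≤ C := nonneg_of_mul_nonneg_left h0 (by positivity)
  rw [norm_smul, norm_mul, norm_exp_ofReal_mul_I, mul_one]
  calc _ ≤ C * (r / (1 + r) ^ 2) * ‖g r‖ := by gcongr
    _ = C * (r * ‖g r‖) * ((1 + r) ^ 2)⁻¹ := by ring
    _ ≤ C * D * ((1 + r) ^ 2)⁻¹ := by gcongr; exact hD r hr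

theorem tendsto_integral_exp_neg_exp {h : ℝ → ℂ} (hh : IntegrableOn h (Ioi 0)) :
    Tendsto (fun R : ℝ => ∫ r in Real.exp (-R)..Real.exp R, h r) atTop
      (𝓝 (∫ r in Ioi 0, h r)) := by
  have h1 : AECover (volume.restrict (Ioi (0 : ℝ))) atTop fun R : ℝ => Ioi (Real.exp (-R)) :=
    aecover_Ioi_of_Ioi (Real.tendsto_exp_neg_atTop_nhds_zero)
  have h2 : AECover (volume.restrict (Ioi (0 : ℝ))) atTop fun R : ℝ => Iic (Real.exp R) :=
    aecover_Iic Real.tendsto_exp_atTop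
  refine ((h1.inter h2).integral_tendsto_of_countably_generated hh).congr' ?_
  filter_upwards [eventually_ge_atTop 0] with R hR
  rw [intervalIntegral.integral_of_le (Real.exp_le_exp.2 (by linarith)), Measure.restrict_restrict
    (measurableSet_Ioi.inter measurableSet_Iic)]
  congr 2
  ext r
  simp only [mem_inter_iff, mem_Ioi, mem_Iic, mem_Ioc]
  exact ⟨fun h => h.1, fun h => ⟨h, (Real.exp_pos _).trans h.1⟩⟩

theorem integral_ray_eq_integral_exp {f : ℂ → ℂ} {σ : ℝ} (hσ : σ ≤ Real.pi)
    (hf : DifferentiableOn ℂ f (sector σ)) {a b θ t : ℝ} (hθ0 : θ ≠ 0) (hθ : |θ| < σ) :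
    ∫ x : ℝ in a..b, f (exp (x + θ * I)) * exp (x + θ * I) / (exp (x + θ * I) - t) =
      ∫ r : ℝ in Real.exp a..Real.exp b,
        (f (r * exp (θ * I)) * exp (θ * I)) • (r * exp (θ * I) - t : ℂ)⁻¹ := by
  rw [← intervalIntegral.integral_deriv_smul_comp'' (f := Real.exp) (f' := Real.exp)
    Real.continuous_exp.continuousOn (fun x _ => (Real.hasDerivAt_exp x).hasDerivWithinAt)
    Real.continuous_exp.continuousOn]
  · refine intervalIntegral.integral_congr fun x _ => ?_
    simp only [Function.comp_apply, Complex.exp_add, ofReal_exp, smul_eq_mul, real_smul]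
    ring
  · have hmaps : MapsTo (fun r : ℝ => (r : ℂ) * exp (θ * I)) (Real.exp '' uIcc a b) (sector σ) := by
      rintro _ ⟨x, _, rfl⟩
      exact ofReal_mul_exp_mem_sector hσ (Real.exp_pos x) hθ
    refine ((hf.continuousOn.comp (by fun_prop) hmaps).mul continuousOn_const).smul ?_
    refine ContinuousOn.inv₀ (by fun_prop) ?_
    rintro _ ⟨x, _, rfl⟩ h
    rw [ofReal_exp, ← Complex.exp_add] at h
    have := (eq_log_of_exp_eq (by simpa using hθ.trans_le hσ) (sub_eq_zero.1 h)).2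
    simp [hθ0] at this

theorem norm_integrand_right_le {f : ℂ → ℂ} {σ C : ℝ} (hσ : σ ≤ Real.pi)
    (hC : ∀ z ∈ sector σ, ‖f z‖ ≤ C * (‖z‖ / (1 + ‖z‖) ^ 2)) {R y t : ℝ} (ht : 0 < t)
    (hy : |y| < σ) (hR : 2 * t ≤ Real.exp R) :
    ‖f (exp (R + y * I)) * exp (R + y * I) / (exp (R + y * I) - t)‖ ≤ 2 * C * Real.exp (-R) := by
  have hn : ‖exp (R + y * I)‖ = Real.exp R := by rw [norm_exp]; simp
  have h1 := hC _ (exp_mem_sector hσ (w := R + y * I) (by simpa using hy))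
  have h2 := norm_sub_norm_le (exp (R + y * I)) t
  rw [hn, norm_real, Real.norm_of_nonneg ht.le] at h2
  rw [hn] at h1
  have hC0 : 0 ≤ C := nonneg_of_mul_nonneg_left ((norm_nonneg _).trans h1)
    (by have := Real.exp_pos R; positivity)
  rw [Real.exp_neg]
  set E := Real.exp R
  have hE : 0 < E := Real.exp_pos R
  rw [norm_div, norm_mul, hn, div_le_iff₀ (by linarith)]
  calc _ ≤ C * (E / (1 + E) ^ 2) * E := by gcongr
    _ ≤ C * (E / E ^ 2) * E := by gcongr; linarith
    _ = 2 * C * E⁻¹ * (E / 2) := by field_simp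
    _ ≤ _ := by gcongr; linarith

theorem norm_integrand_left_le {f : ℂ → ℂ} {σ C : ℝ} (hσ : σ ≤ Real.pi)
    (hC : ∀ z ∈ sector σ, ‖f z‖ ≤ C * (‖z‖ / (1 + ‖z‖) ^ 2)) {R y t : ℝ}
    (hy : |y| < σ) (hR : 2 * Real.exp (-R) ≤ t) :
    ‖f (exp ((-R : ℝ) + y * I)) * exp ((-R : ℝ) + y * I) / (exp ((-R : ℝ) + y * I) - t)‖ ≤
      2 * C * Real.exp (-R) := by
  have hn : ‖exp ((-R : ℝ) + y * I)‖ = Real.exp (-R) := by rw [norm_exp]; simp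
  have h1 := hC _ (exp_mem_sector hσ (w := (-R : ℝ) + y * I) (by simpa using hy))
  have h2 := norm_sub_norm_le (t : ℂ) (exp ((-R : ℝ) + y * I))
  have hE : 0 < Real.exp (-R) := Real.exp_pos _
  rw [norm_sub_rev, hn, norm_real, Real.norm_of_nonneg (by linarith)] at h2
  rw [hn] at h1
  have hC0 : 0 ≤ C := nonneg_of_mul_nonneg_left ((norm_nonneg _).trans h1) (by positivity)
  set E := Real.exp (-R)
  rw [norm_div, norm_mul, hn, div_le_iff₀ (by linarith)]
  calc _ ≤ C * (E / (1 + E) ^ 2) * E := by gcongr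
    _ ≤ C * (E / 1 ^ 2) * E := by gcongr; linarith
    _ ≤ 2 * C * E * E := by nlinarith [mul_nonneg hC0 (mul_nonneg hE.le hE.le)]
    _ ≤ _ := by gcongr; linarith

/-- Cauchy's integral formula on a sector, for functions decaying at `0` and `∞`. -/
theorem cauchy_formula_sector {f : ℂ → ℂ} {σ C : ℝ} (hσ : σ ≤ Real.pi)
    (hf : DifferentiableOn ℂ f (sector σ))
    (hC : ∀ z ∈ sector σ, ‖f z‖ ≤ C * (‖z‖ / (1 + ‖z‖) ^ 2)) {s t : ℝ} (ht : 0 < t) (hs : 0 < s)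
    (hsσ : s < σ) :
    (∫ r : ℝ in Ioi 0, (f (r * exp ((-s : ℝ) * I)) * exp ((-s : ℝ) * I)) •
        (r * exp ((-s : ℝ) * I) - t : ℂ)⁻¹) -
      (∫ r : ℝ in Ioi 0, (f (r * exp (s * I)) * exp (s * I)) • (r * exp (s * I) - t : ℂ)⁻¹) =
      2 * Real.pi * I * f t := by
  have hsπ : s < Real.pi := hsσ.trans_le hσ
  have hint : ∀ θ : ℝ, |θ| = s → IntegrableOn (fun r : ℝ =>
      (f (r * exp (θ * I)) * exp (θ * I)) • (r * exp (θ * I) - t : ℂ)⁻¹) (Ioi 0) := by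
    intro θ hθ
    have hκ := sqrt_one_sub_cos_pos ⟨hs, hsπ⟩
    set κ := √((1 - Real.cos s) / 2)
    have hd : ∀ r : ℝ, 0 < r → κ * (r + t) ≤ ‖(r * exp (θ * I) - t : ℂ)‖ := fun r hr => by
      have := norm_sub_ofReal_ge ⟨hs, hsπ⟩ (lam := r * exp (θ * I))
        (by rw [arg_ofReal_mul_exp hr (hθ ▸ hsπ), hθ]) ht.le
      rwa [norm_ofReal_mul_exp hr.le] at this
    refine integrableOn_ray hσ hf hC (hθ ▸ hsσ) (D := κ⁻¹) ?_ fun r hr => ?_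
    · refine ContinuousOn.inv₀ (by fun_prop) fun r hr => ?_
      have hr : 0 < r := hr
      exact norm_pos_iff.1 (lt_of_lt_of_le (by positivity) (hd r hr))
    · have h0 : 0 < ‖(r * exp (θ * I) - t : ℂ)‖ := lt_of_lt_of_le (by positivity) (hd r hr)
      rw [norm_inv, ← div_eq_mul_inv, div_le_iff₀ h0, inv_mul_eq_div, le_div_iff₀ hκ]
      nlinarith [hd r hr, mul_pos hκ ht]
  -- The vertical sides of the rectangle do not contribute in the limit.
  have hside : ∀ (c : ℝ → ℝ), (∀ᶠ R in atTop, ∀ y : ℝ, |y| < σ →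
      ‖f (exp (c R + y * I)) * exp (c R + y * I) / (exp (c R + y * I) - t)‖ ≤
        2 * C * Real.exp (-R)) →
      Tendsto (fun R => I * ∫ y : ℝ in -s..s,
        f (exp (c R + y * I)) * exp (c R + y * I) / (exp (c R + y * I) - t)) atTop (𝓝 0) := by
    intro c hc
    have h0 : Tendsto (fun R => 2 * C * Real.exp (-R) * |s - -s|) atTop (𝓝 0) := by
      simpa using (Real.tendsto_exp_neg_atTop_nhds_zero.const_mul (2 * C)).mul_const |s - -s|
    refine squeeze_zero_norm' ?_ h0
    filter_upwards [hc] with R hR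
    rw [norm_mul, norm_I, one_mul]
    refine intervalIntegral.norm_integral_le_of_norm_le_const fun y hy => hR y ?_
    rw [uIoc_of_le (by linarith)] at hy
    exact (abs_le.2 ⟨hy.1.le, hy.2⟩).trans_lt hsσ
  have hright := hside (fun R => R) (by
    filter_upwards [Real.tendsto_exp_atTop.eventually_ge_atTop (2 * t)] with R hR y hy
    exact norm_integrand_right_le hσ hC ht hy hR)
  have hleft := hside (fun R => -R) (by
    filter_upwards [Real.tendsto_exp_neg_atTop_nhds_zero.eventually_le_const
      (half_pos ht)] with R hR y hy
    exact norm_integrand_left_le hσ hC hy (by linarith))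
  have htot := (((tendsto_integral_exp_neg_exp (hint (-s) (by rw [abs_neg, abs_of_pos hs]))).sub
    (tendsto_integral_exp_neg_exp (hint s (abs_of_pos hs)))).add hright).sub hleft
  rw [add_zero, sub_zero] at htot
  refine tendsto_nhds_unique htot (tendsto_const_nhds.congr' ?_)
  filter_upwards [eventually_gt_atTop |Real.log t|] with R hR
  obtain ⟨h1, h2⟩ := abs_lt.1 hR
  rw [← rectangle_integral_cauchy hσ hf ht h1 h2 hs hsσ,
    integral_ray_eq_integral_exp hσ hf (neg_ne_zero.2 hs.ne') (by rwa [abs_neg, abs_of_pos hs]),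
    integral_ray_eq_integral_exp hσ hf hs.ne' (by rwa [abs_of_pos hs])]

/-! ### Interpolation by bounded holomorphic functions on a sector -/

theorem differentiable_dslope_sin : Differentiable ℂ (dslope sin 0) := by
  rw [← differentiableOn_univ, differentiableOn_dslope univ_mem]
  exact differentiable_sin.differentiableOn

theorem norm_sin_le_exp (z : ℂ) : ‖sin z‖ ≤ Real.exp |z.im| := by
  have h1 : ‖exp (-z * I)‖ ≤ Real.exp |z.im| := by
    rw [norm_exp]
    exact Real.exp_le_exp.2 (by simpa using le_abs_self _)
  have h2 : ‖exp (z * I)‖ ≤ Real.exp |z.im| := by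
    rw [norm_exp]
    exact Real.exp_le_exp.2 (by simpa using neg_le_abs _)
  rw [sin, norm_div, norm_mul, norm_I, mul_one, Complex.norm_ofNat, div_le_iff₀ two_pos]
  linarith [norm_sub_le (exp (-z * I)) (exp (z * I))]

theorem exists_norm_dslope_sin_le (T : ℝ) :
    ∃ B : ℝ, ∀ z : ℂ, |z.im| ≤ T → ‖dslope sin 0 z‖ ≤ B := by
  obtain ⟨B, hB⟩ := (isCompact_closedBall (0 : ℂ) 1).exists_bound_of_continuousOn
    differentiable_dslope_sin.continuous.continuousOn
  refine ⟨max B (Real.exp T), fun z hz => ?_⟩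
  rcases le_or_gt ‖z‖ 1 with h | h
  · exact (hB z (by simpa using h)).trans (le_max_left _ _)
  · have h0 : z ≠ 0 := norm_pos_iff.1 (zero_lt_one.trans h)
    rw [dslope_of_ne _ h0, slope_def_field, sin_zero, sub_zero, sub_zero, norm_div]
    refine (div_le_of_le_mul₀ (norm_nonneg _) (Real.exp_pos T).le ?_).trans (le_max_right _ _)
    calc ‖sin z‖ ≤ Real.exp T := (norm_sin_le_exp z).trans (Real.exp_le_exp.2 hz)
      _ ≤ Real.exp T * ‖z‖ := le_mul_of_one_le_right (Real.exp_pos T).le h.le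

/-- The cardinal function of the lattice `ℤ log 2`: the entire function
`sinc (π u / log 2) exp (-u²)`, with the value `1` at `0` and `0` at the other points of the
lattice. -/
def cardinalKernel (u : ℂ) : ℂ :=
  dslope sin 0 ((Real.pi / Real.log 2 : ℝ) * u) * exp (-u ^ 2)

theorem differentiable_cardinalKernel : Differentiable ℂ cardinalKernel :=
  (differentiable_dslope_sin.comp (differentiable_id.const_mul _)).mul
    ((differentiable_id.pow 2).neg.cexp)

theorem cardinalKernel_int_mul_log (k : ℤ) :
    cardinalKernel (k * Real.log 2 : ℝ) = if k = 0 then 1 else 0 := by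
  have hl : Real.log 2 ≠ 0 := (Real.log_pos one_lt_two).ne'
  rw [cardinalKernel, ← ofReal_mul, show Real.pi / Real.log 2 * (k * Real.log 2) = k * Real.pi by
    field_simp]
  split_ifs with h
  · simp [h, dslope_same, (hasDerivAt_sin 0).deriv]
  · have h0 : ((k * Real.pi : ℝ) : ℂ) ≠ 0 := by
      rw [ofReal_ne_zero]
      exact mul_ne_zero (Int.cast_ne_zero.2 h) Real.pi_ne_zero
    rw [dslope_of_ne _ h0, slope_def_field, ← ofReal_sin, Real.sin_int_mul_pi]
    simp

theorem exists_norm_cardinalKernel_le (τ : ℝ) :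
    ∃ D : ℝ, 0 ≤ D ∧ ∀ u : ℂ, |u.im| ≤ τ → ‖cardinalKernel u‖ ≤ D * Real.exp (-|u.re|) := by
  obtain ⟨B, hB⟩ := exists_norm_dslope_sin_le (Real.pi / Real.log 2 * τ)
  have hl : 0 < Real.log 2 := Real.log_pos one_lt_two
  have hp : 0 < Real.pi / Real.log 2 := by positivity
  refine ⟨|B| * Real.exp (τ ^ 2 + 1), by positivity, fun u hu => ?_⟩
  have h1 : ‖dslope sin 0 ((Real.pi / Real.log 2 : ℝ) * u)‖ ≤ |B| := by
    refine (hB _ ?_).trans (le_abs_self B)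
    rw [im_ofReal_mul, abs_mul, abs_of_pos hp]
    exact mul_le_mul_of_nonneg_left hu hp.le
  have h2 : ‖exp (-u ^ 2)‖ ≤ Real.exp (τ ^ 2 + 1 + -|u.re|) := by
    rw [norm_exp]
    refine Real.exp_le_exp.2 ?_
    have h3 : (-u ^ 2).re = u.im ^ 2 - u.re ^ 2 := by simp [sq]
    have h4 : u.im ^ 2 ≤ τ ^ 2 := sq_le_sq' (by linarith [neg_abs_le u.im]) ((le_abs_self _).trans hu)
    rw [h3]
    nlinarith [sq_abs u.re, sq_nonneg (|u.re| - 1)]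
  rw [cardinalKernel, norm_mul, mul_assoc, ← Real.exp_add]
  exact mul_le_mul h1 h2 (norm_nonneg _) (abs_nonneg B)

/-- The translates of `exp (-|x|)` by the points of a half-lattice have uniformly bounded sums. -/
theorem exists_sum_exp_neg_abs_le :
    ∃ S : ℝ, ∀ (x : ℝ) (N : ℕ),
      ∑ k ∈ Finset.range N, Real.exp (-|x - (k + 1) * Real.log 2|) ≤ S := by
  have hl : 0 < Real.log 2 := Real.log_pos one_lt_two
  set q : ℝ := Real.exp (-Real.log 2) with hq
  have hs : Summable fun n : ℤ => q ^ n.natAbs := by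
    have h : Summable fun n : ℕ => q ^ n :=
      summable_geometric_of_lt_one (Real.exp_pos _).le ((Real.exp_lt_one_iff).2 (by linarith))
    exact summable_int_iff_summable_nat_and_neg.2 ⟨by simpa using h, by simpa using h⟩
  refine ⟨Real.exp (Real.log 2) * ∑' n : ℤ, q ^ n.natAbs, fun x N => ?_⟩
  -- `j` is the lattice point just below `x`.
  set j := ⌊x / Real.log 2⌋
  have hj1 : j * Real.log 2 ≤ x := (le_div_iff₀ hl).1 (Int.floor_le _)
  have hj2 : x < (j + 1) * Real.log 2 := (div_lt_iff₀ hl).1 (Int.lt_floor_add_one _)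
  have hterm : ∀ k : ℕ, Real.exp (-|x - (k + 1) * Real.log 2|) ≤
      Real.exp (Real.log 2) * q ^ (j - (k + 1)).natAbs := fun k => by
    rw [hq, ← Real.exp_nat_mul, ← Real.exp_add, Nat.cast_natAbs]
    refine Real.exp_le_exp.2 ?_
    push_cast
    have h1 : |((j : ℝ) - (k + 1)) * Real.log 2| ≤ |x - (k + 1) * Real.log 2| + Real.log 2 := by
      have h2 : ((j : ℝ) - (k + 1)) * Real.log 2 =
        (x - (k + 1) * Real.log 2) + (j * Real.log 2 - x) := by ring
      rw [h2]
      refine (abs_add_le _ _).trans (add_le_add_right ?_ _)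
      rw [abs_le]
      constructor <;> linarith
    rw [abs_mul, abs_of_pos hl] at h1
    linarith
  have hinj : Function.Injective fun k : ℕ => j - ((k : ℤ) + 1) := fun k l h => by
    simp only at h
    omega
  calc _ ≤ ∑ k ∈ Finset.range N, Real.exp (Real.log 2) * q ^ (j - ((k : ℤ) + 1)).natAbs :=
        Finset.sum_le_sum fun k _ => hterm k
    _ = Real.exp (Real.log 2) *
        ∑ n ∈ (Finset.range N).map ⟨_, hinj⟩, q ^ n.natAbs := by
      rw [Finset.sum_map, Finset.mul_sum]
      rfl
    _ ≤ _ := by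
      gcongr
      exact hs.sum_le_tsum _ fun n _ => pow_nonneg (Real.exp_pos _).le _

theorem exp_neg_abs_log_le {r : ℝ} (hr : 0 < r) :
    Real.exp (-|Real.log r|) ≤ 4 * (r / (1 + r) ^ 2) := by
  rw [← mul_div_assoc, le_div_iff₀ (by positivity)]
  rcases le_total r 1 with h | h
  · rw [abs_of_nonpos (Real.log_nonpos hr.le h), neg_neg, Real.exp_log hr]
    nlinarith [mul_nonneg hr.le (sub_nonneg.2 h)]
  · rw [abs_of_nonneg (Real.log_nonneg h), Real.exp_neg, Real.exp_log hr, inv_mul_le_iff₀ hr]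
    nlinarith

/-- The points `2 ^ (m + 1)` are interpolating for bounded holomorphic functions on a sector:
bounded finitely supported data are attained by functions with a uniform bound, which moreover decay
at `0` and `∞`. -/
theorem exists_interpolation {σ : ℝ} (hσ : σ ≤ Real.pi) :
    ∃ M : ℝ, ∀ (N : ℕ) (c : ℕ → ℂ), (∀ k, ‖c k‖ ≤ 1) → ∃ f : ℂ → ℂ,
      DifferentiableOn ℂ f (sector σ) ∧
      (∃ C : ℝ, ∀ z ∈ sector σ, ‖f z‖ ≤ C * (‖z‖ / (1 + ‖z‖) ^ 2)) ∧
      (∀ z ∈ sector σ, ‖f z‖ ≤ M) ∧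
      ∀ m : ℕ, f ((2 ^ (m + 1) : ℝ) : ℂ) = if m < N then c m else 0 := by
  obtain ⟨D, hD0, hD⟩ := exists_norm_cardinalKernel_le σ
  obtain ⟨S, hS⟩ := exists_sum_exp_neg_abs_le
  have hbound : ∀ (k : ℕ), ∀ z ∈ sector σ,
      ‖cardinalKernel (log z - ((k + 1) * Real.log 2 : ℝ))‖ ≤
        D * Real.exp (-|Real.log ‖z‖ - (k + 1) * Real.log 2|) := fun k z hz => by
    have h := hD (log z - ((k + 1) * Real.log 2 : ℝ))
      (by rw [sub_im, log_im, ofReal_im, sub_zero]; exact hz.2.le)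
    rwa [sub_re, log_re, ofReal_re] at h
  refine ⟨D * S, fun N c hc => ⟨fun z => ∑ k ∈ Finset.range N,
    c k * cardinalKernel (log z - ((k + 1) * Real.log 2 : ℝ)), ?_, ?_, ?_, ?_⟩⟩
  · refine DifferentiableOn.fun_sum fun k _ => DifferentiableOn.const_mul ?_ _
    refine differentiable_cardinalKernel.comp_differentiableOn (DifferentiableOn.sub_const ?_ _)
    exact fun z hz => (differentiableAt_log (sector_subset_slitPlane hσ hz)).differentiableWithinAt
  · refine ⟨∑ k ∈ Finset.range N, D * (Real.exp ((k + 1) * Real.log 2) * 4), fun z hz => ?_⟩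
    -- Translation by `(k + 1) log 2` costs at most the factor `exp ((k + 1) log 2)`.
    rw [Finset.sum_mul]
    refine norm_sum_le_of_le _ fun k _ => ?_
    rw [norm_mul, mul_assoc, mul_assoc]
    refine (mul_le_of_le_one_left (norm_nonneg _) (hc k)).trans ((hbound k z hz).trans ?_)
    refine mul_le_mul_of_nonneg_left (le_trans ?_ (mul_le_mul_of_nonneg_left
      (exp_neg_abs_log_le (norm_pos_iff.2 hz.1)) (Real.exp_pos _).le)) hD0
    rw [← Real.exp_add]
    refine Real.exp_le_exp.2 ?_
    have h1 := abs_sub_abs_le_abs_sub (Real.log ‖z‖) ((k + 1) * Real.log 2)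
    have h2 : 0 ≤ ((k : ℝ) + 1) * Real.log 2 :=
      mul_nonneg (by positivity) (Real.log_pos one_lt_two).le
    rw [abs_of_nonneg h2] at h1
    linarith
  · intro z hz
    calc _ ≤ ∑ k ∈ Finset.range N, D * Real.exp (-|Real.log ‖z‖ - (k + 1) * Real.log 2|) :=
          norm_sum_le_of_le _ fun k _ => by
            rw [norm_mul]
            exact (mul_le_of_le_one_left (norm_nonneg _) (hc k)).trans (hbound k z hz)
      _ ≤ D * S := by
          rw [← Finset.mul_sum]
          exact mul_le_mul_of_nonneg_left (hS _ N) hD0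
  · intro m
    have h1 : ∀ k : ℕ, cardinalKernel (log ((2 ^ (m + 1) : ℝ) : ℂ) - ((k + 1) * Real.log 2 : ℝ)) =
        if k = m then 1 else 0 := fun k => by
      have h2 : log ((2 ^ (m + 1) : ℝ) : ℂ) - ((k + 1) * Real.log 2 : ℝ) =
          ((((m - k : ℤ) : ℝ) * Real.log 2 : ℝ) : ℂ) := by
        rw [← ofReal_log (by positivity), Real.log_pow, ← ofReal_sub]
        push_cast
        ring
      rw [h2, cardinalKernel_int_mul_log]
      refine if_congr ?_ rfl rfl
      omega
    simp only [h1]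
    simp

/-! ### The functional calculus on basis vectors -/

theorem IsResolventAt.apply_of_eigenvector {A : X →ₗ.[ℂ] X} {lam mu : ℂ} {R : X →L[ℂ] X}
    (h : IsResolventAt A lam R) {x : A.domain} (hx : A x = mu • (x : X)) :
    R x = (lam - mu)⁻¹ • (x : X) := by
  have h1 := h.2 x
  rw [hx, ← sub_smul, map_smul] at h1
  by_cases h0 : lam - mu = 0
  · rw [h0, zero_smul] at h1
    rw [← h1, map_zero, smul_zero]
  · rw [eq_inv_smul_iff₀ h0, h1]

/-- The resolvent is continuous where `|lam| ‖R(lam, A)‖` is bounded. -/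
theorem continuousOn_resolvent {A : X →ₗ.[ℂ] X} {S : Set ℂ} {C : ℝ} (h0 : (0 : ℂ) ∉ S)
    (hS : S ⊆ resolventSet A) (hC : ∀ lam ∈ S, ‖lam‖ * ‖resolvent A lam‖ ≤ C) :
    ContinuousOn (resolvent A) S := by
  intro mu hmu
  have hpos : ∀ lam ∈ S, 0 < ‖lam‖ := fun lam hl => norm_pos_iff.2 fun h => h0 (h ▸ hl)
  have hR : ∀ lam ∈ S, ‖resolvent A lam‖ ≤ C / ‖lam‖ := fun lam hl => by
    rw [le_div_iff₀ (hpos lam hl), mul_comm]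
    exact hC lam hl
  have hlim : Tendsto (fun lam : ℂ => ‖mu - lam‖ * (C / ‖lam‖ * (C / ‖mu‖))) (𝓝[S] mu) (𝓝 0) := by
    have hne : ‖mu‖ ≠ 0 := (hpos mu hmu).ne'
    have hc : ContinuousAt (fun lam : ℂ => ‖mu - lam‖ * (C / ‖lam‖ * (C / ‖mu‖))) mu := by
      fun_prop (disch := assumption)
    simpa using hc.tendsto.mono_left nhdsWithin_le_nhds
  rw [ContinuousWithinAt, tendsto_iff_norm_sub_tendsto_zero]
  refine squeeze_zero' (.of_forall fun _ => norm_nonneg _) ?_ hlim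
  filter_upwards [self_mem_nhdsWithin] with lam hl
  rw [resolvent_sub_resolvent (hS hl) (hS hmu), norm_smul]
  refine mul_le_mul_of_nonneg_left ((ContinuousLinearMap.opNorm_comp_le _ _).trans ?_)
    (norm_nonneg _)
  exact mul_le_mul (hR lam hl) (hR mu hmu) (norm_nonneg _)
    ((norm_nonneg _).trans (hR lam hl))

/-- The contour integral acts on an eigenvector with a positive eigenvalue `t` as multiplication by
`f t`. The integral converges in operator norm, so it can be evaluated at the eigenvector, where
Cauchy's formula applies. -/
theorem contourIntegral_apply_of_eigenvector [CompleteSpace X] {A : X →ₗ.[ℂ] X} {f : ℂ → ℂ}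
    {σ s t C D : ℝ} (hσ : σ ≤ Real.pi) (hs : 0 < s) (hsσ : s < σ)
    (hf : DifferentiableOn ℂ f (sector σ))
    (hC : ∀ z ∈ sector σ, ‖f z‖ ≤ C * (‖z‖ / (1 + ‖z‖) ^ 2))
    (hA : ∀ lam : ℂ, lam ≠ 0 → s ≤ |arg lam| →
      lam ∈ resolventSet A ∧ ‖lam‖ * ‖resolvent A lam‖ ≤ D)
    (ht : 0 < t) {x : A.domain} (hx : A x = (t : ℂ) • (x : X)) :
    contourIntegral A s f (x : X) = f t • (x : X) := by
  have hray : ∀ θ : ℝ, |θ| = s → ∀ r : ℝ, 0 < r →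
      ((r : ℂ) * exp (θ * I) ≠ 0 ∧ s ≤ |arg ((r : ℂ) * exp (θ * I))|) := fun θ hθ r hr =>
    ⟨mul_ne_zero (ofReal_ne_zero.2 hr.ne') (exp_ne_zero _), by
      rw [arg_ofReal_mul_exp hr (hθ ▸ hsσ.trans_le hσ), hθ]⟩
  have hR : ContinuousOn (resolvent A) {lam | lam ≠ 0 ∧ s ≤ |arg lam|} :=
    continuousOn_resolvent (fun h => h.1 rfl) (fun lam h => (hA lam h.1 h.2).1)
      fun lam h => (hA lam h.1 h.2).2
  have hint : ∀ θ : ℝ, |θ| = s →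
      (∫ r in Ioi (0 : ℝ), (f (r * exp (θ * I)) * exp (θ * I)) •
        resolvent A (r * exp (θ * I))) (x : X) =
      (∫ r in Ioi (0 : ℝ), (f (r * exp (θ * I)) * exp (θ * I)) • (r * exp (θ * I) - t : ℂ)⁻¹) •
        (x : X) := by
    intro θ hθ
    have hi : IntegrableOn (fun r : ℝ => (f (r * exp (θ * I)) * exp (θ * I)) •
        resolvent A (r * exp (θ * I))) (Ioi 0) := by
      refine integrableOn_ray hσ hf hC (hθ ▸ hsσ) (D := D)
        (hR.comp (by fun_prop) fun r hr => hray θ hθ r hr) fun r hr => ?_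
      obtain ⟨h1, h2⟩ := hray θ hθ r hr
      have := (hA _ h1 h2).2
      rwa [norm_ofReal_mul_exp hr.le] at this
    rw [ContinuousLinearMap.integral_apply hi, ← integral_smul_const]
    refine setIntegral_congr_fun measurableSet_Ioi fun r hr => ?_
    obtain ⟨h1, h2⟩ := hray θ hθ r hr
    simp only [smul_apply]
    rw [(resolvent_spec (hA _ h1 h2).1).apply_of_eigenvector hx, smul_smul, smul_eq_mul]
  have e : exp (-(s * I)) = exp ((-s : ℝ) * I) := by simp
  rw [contourIntegral, e]
  simp only [smul_apply, sub_apply]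
  rw [hint (-s) (by rw [abs_neg, abs_of_pos hs]), hint s (abs_of_pos hs), ← sub_smul,
    cauchy_formula_sector hσ hf hC ht hs hsσ, smul_smul, inv_mul_cancel_left₀ two_pi_I_ne_zero]

/-! ### Unconditionality -/

/-- A basis is unconditional if the multipliers with finitely supported symbols bounded by `1` are
uniformly bounded: a finite subsum beyond the index `n` is such a multiplier applied to
`P_N x - P_n x`. -/
theorem isUnconditional_of_bounded_multipliers [CompleteSpace X] (b : SchauderBasis ℂ X) {M : ℝ}
    (h : ∀ (N : ℕ) (c : ℕ → ℂ), (∀ k, ‖c k‖ ≤ 1) → ∃ T : X →L[ℂ] X, ‖T‖ ≤ M ∧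
      ∀ m, T (b m) = (if m < N then c m else 0) • b m) :
    IsUnconditional b := by
  intro x
  have hM : 0 ≤ M := by
    obtain ⟨T, hT, -⟩ := h 0 0 (by simp)
    exact (norm_nonneg T).trans hT
  rw [summable_iff_vanishing_norm]
  intro ε hε
  have hx : CauchySeq fun n => b.proj n x := (b.tendsto_proj x).cauchySeq
  obtain ⟨n, hn⟩ := Metric.cauchySeq_iff'.1 hx (ε / (M + 1)) (by positivity)
  refine ⟨Finset.range n, fun F hF => ?_⟩
  set N := max n (F.sup id + 1)
  have hFN : ∀ m ∈ F, n ≤ m ∧ m < N := fun m hm => by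
    have h1 := Finset.disjoint_left.1 hF hm
    have h2 : m ≤ F.sup id := Finset.le_sup (f := id) hm
    rw [Finset.mem_range, not_lt] at h1
    exact ⟨h1, lt_max_of_lt_right (Nat.lt_succ_of_le h2)⟩
  obtain ⟨T, hT, hTb⟩ := h N (fun m => if m ∈ F then 1 else 0) fun k => by split_ifs <;> simp
  have hsum : ∑ m ∈ F, b.coord m x • b m = T (b.proj N x - b.proj n x) := by
    have h1 : b.proj N x - b.proj n x = ∑ m ∈ Finset.Ico n N, b.coord m x • b m := by
      rw [Finset.sum_Ico_eq_sub _ (le_max_left _ _), SchauderBasis.proj_apply,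
        SchauderBasis.proj_apply]
    rw [h1, map_sum, ← Finset.sum_subset (s₁ := F)
      (fun m hm => Finset.mem_Ico.2 (hFN m hm))]
    · refine Finset.sum_congr rfl fun m hm => ?_
      rw [map_smul, hTb, if_pos (hFN m hm).2, if_pos hm, one_smul]
    · intro m _ hm
      simp [hTb, hm]
  rw [hsum]
  have hd := hn N (le_max_left _ _)
  rw [dist_eq_norm, lt_div_iff₀ (by positivity)] at hd
  calc _ ≤ M * ‖b.proj N x - b.proj n x‖ := T.le_of_opNorm_le hT _
    _ ≤ ‖b.proj N x - b.proj n x‖ * (M + 1) := by nlinarith [norm_nonneg (b.proj N x - b.proj n x)]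
    _ < ε := hd

theorem isUnconditional_of_hasBoundedHInftyCalculus [CompleteSpace X] (b : SchauderBasis ℂ X)
    (h : HasBoundedHInftyCalculus (schauderMultiplier b fun m => 2 ^ (m + 1))) :
    IsUnconditional b := by
  obtain ⟨σ, ⟨hσ0, hσπ⟩, K, hK⟩ := h
  rw [sectorialAngle_two_pow] at hσ0
  obtain ⟨D, hD⟩ := exists_resolvent_bound b (ω := σ / 2) ⟨by linarith, by linarith⟩
  obtain ⟨M, hM⟩ := exists_interpolation hσπ.le
  refine isUnconditional_of_bounded_multipliers b (M := |K| * M) fun N c hc => ?_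
  obtain ⟨f, hf, ⟨C, hC⟩, hfM, hfc⟩ := hM N c hc
  refine ⟨functionalCalculus (schauderMultiplier b fun m => 2 ^ (m + 1)) σ f, ?_, fun m => ?_⟩
  · -- The decay of `f` is that of the class `H₀^∞` with the exponent `ε = 1`.
    have hf0 : IsHZeroInfty σ f := by
      refine ⟨hf, |C| + 1, by positivity, 1, one_pos, fun z hz => (hC z hz).trans ?_⟩
      rw [mul_one, Real.rpow_one, Real.rpow_two]
      gcongr
      linarith [le_abs_self C]
    have hne : Nonempty (sector σ) := ⟨⟨1, by simpa using ofReal_mem_sector hσ0 one_pos⟩⟩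
    have hsup : hInftyNorm σ f ≤ M := ciSup_le fun z => hfM z z.2
    have hsup0 : 0 ≤ hInftyNorm σ f := Real.iSup_nonneg fun z => norm_nonneg _
    calc _ ≤ K * hInftyNorm σ f := hK f hf0
      _ ≤ |K| * hInftyNorm σ f := mul_le_mul_of_nonneg_right (le_abs_self K) hsup0
      _ ≤ |K| * M := mul_le_mul_of_nonneg_left hsup (abs_nonneg K)
  · -- The angle of integration is `σ / 2`, as the sectorial angle is `0`.
    obtain ⟨hx, hAx⟩ := schauderMultiplier_basis b (fun m => 2 ^ (m + 1)) m
    rw [functionalCalculus, sectorialAngle_two_pow, zero_add, ← hfc m]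
    exact contourIntegral_apply_of_eigenvector (t := 2 ^ (m + 1)) hσπ.le (by linarith)
      (by linarith) hf hC hD (by positivity) (x := ⟨b m, hx⟩) (hAx.trans (by simp))

end Sectorial

end

/-- The basis vectors `e_1, e_2, …` are indexed here as `b 0, b 1, …`, so the multiplier sequence
`(2 ^ m)_{m ≥ 1}` reads `m ↦ 2 ^ (m + 1)`. -/
theorem mainTheorem2 {X : Type*} [NormedAddCommGroup X] [NormedSpace ℂ X] [CompleteSpace X]
    (b : SchauderBasis ℂ X) (hb : Sectorial.IsConditional b) :
    Sectorial.IsSectorial (Sectorial.schauderMultiplier b fun m => 2 ^ (m + 1)) ∧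
      Sectorial.sectorialAngle (Sectorial.schauderMultiplier b fun m => 2 ^ (m + 1)) = 0 ∧
      ¬ Sectorial.HasBoundedHInftyCalculus
          (Sectorial.schauderMultiplier b fun m => 2 ^ (m + 1)) :=
  ⟨Sectorial.isSectorial_two_pow b, Sectorial.sectorialAngle_two_pow b,
    fun h => hb (Sectorial.isUnconditional_of_hasBoundedHInftyCalculus b h)⟩
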